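/- Let $X$ be a complex Banach space with open unit ball $B$, and let $\bar B^{**}$ be the closed unit ball of the bidual $X^{**}$. Let $H^\infty(B)$ be the algebra of bounded holomorphic functions on $B$ with the supremum norm, and $A_u(B)$ its subalgebra of uniformly continuous functions. Let $H(B)$ be any closed subalgebra of $H^\infty(B)$ with $A_u(B)\subset H(B)\subset H^\infty(B)$. Let $M_{H(B)}$ be its spectrum, i.e. the set of nonzero multiplicative linear functionals on $H(B)$, and for $f\in H(B)$ let $\hat f:M_{H(B)}\to\mathbb C$, $\hat f(\tau)=\tau(f)$, be its Gelfand transform. For a continuous $n$-homogeneous polynomial $P$ on $X$ with associated symmetric $n$-linear form $A$, let $\tilde P$ be its Aron-Berner extension to $X^{**}$, i.e. the restriction to the diagonal of the form obtained from $A$ by extending it to $X^{**}$ by weak-star continuity, one variable at a time; for a continuous polynomial $P=\sum_{n\le N}P_n$ put $\tilde P=\sum_{n\le N}\tilde P_n$. For $g\in A_u(B)$ with Taylor series $\sum_n P_n$ at $0$, the Aron-Berner extension $\tilde g$ is the function that equals $\sum_n\tilde P_n$ on the open unit ball of $X^{**}$, extended continuously to $\bar B^{**}$. For $x_0^{**}\in\bar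 B^{**}$ and $f\in H(B)$, let the polynomial cluster set $Cl_B^{\mathcal P}(f,x_0^{**})$ be the set of all $\lambda\in\mathbb C$ for which there is a net $(x_\alpha)$ in $B$ with $P(x_\alpha)\to\tilde P(x_0^{**})$ for every continuous polynomial $P$ on $X$ and $f(x_\alpha)\to\lambda$. Let the polynomial fiber $M^{\mathcal P}_{x_0^{**}}$ be the set of all $\tau\in M_{H(B)}$ such that $\tau(g)=\tilde g(x_0^{**})$ for all $g\in A_u(B)$. Theorem. For every $x_0^{**}\in\bar B^{**}$ and every $f\in H(B)$, $$Cl_B^{\mathcal P}(f,x_0^{**})\subset\hat f\big(M^{\mathcal P}_{x_0^{**}}\big).$$ -/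

import Mathlib

open Filter Topology Metric
open scoped BoundedContinuousFunction

noncomputable section

namespace PolyCluster

universe u

/-- The open unit ball `B` of `X`, as a set. -/
abbrev unitBall (X : Type u) [NormedAddCommGroup X] : Set X := ball (0 : X) 1

/-- The bidual `X**` with its norm. -/
abbrev Bidual (X : Type u) [NormedAddCommGroup X] [NormedSpace ℂ X] : Type u :=
  StrongDual ℂ (StrongDual ℂ X)

section Functions

variable {X : Type u} [NormedAddCommGroup X]

/-- The extension of a function on `B` to `X` by zero outside `B`. It only serves to speak of
power series expansions and derivatives at points of the open set `B`. -/
def extendZero (f : unitBall X →ᵇ ℂ) : X → ℂ :=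
  Function.extend (Subtype.val : unitBall X → X) f 0

theorem extendZero_apply (f : unitBall X →ᵇ ℂ) (x : unitBall X) :
    extendZero f (x : X) = f x :=
  Subtype.val_injective.extend_apply _ _ _

theorem uniformContinuous_mul {f g : unitBall X →ᵇ ℂ} (hf : UniformContinuous f)
    (hg : UniformContinuous g) : UniformContinuous (f * g) := by
  rw [Metric.uniformContinuous_iff] at *
  intro ε hε
  have hC : 0 < ‖f‖ + ‖g‖ + 1 := by positivity
  obtain ⟨d₁, hd₁, h₁⟩ := hf (ε / (‖f‖ + ‖g‖ + 1)) (by positivity)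
  obtain ⟨d₂, hd₂, h₂⟩ := hg (ε / (‖f‖ + ‖g‖ + 1)) (by positivity)
  refine ⟨min d₁ d₂, lt_min hd₁ hd₂, fun {a b} hab => ?_⟩
  have e₁ := h₁ (hab.trans_le (min_le_left _ _))
  have e₂ := h₂ (hab.trans_le (min_le_right _ _))
  rw [dist_eq_norm] at e₁ e₂ ⊢
  have hε' : 0 < ε / (‖f‖ + ‖g‖ + 1) := by positivity
  have key : (f * g) a - (f * g) b = f a * (g a - g b) + (f a - f b) * g b := by
    simp only [BoundedContinuousFunction.coe_mul, Pi.mul_apply]; ring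
  calc ‖(f * g) a - (f * g) b‖
      ≤ ‖f a‖ * ‖g a - g b‖ + ‖f a - f b‖ * ‖g b‖ := by
        rw [key, ← norm_mul, ← norm_mul]; exact norm_add_le _ _
    _ ≤ ‖f‖ * (ε / (‖f‖ + ‖g‖ + 1)) + (ε / (‖f‖ + ‖g‖ + 1)) * ‖g‖ := by
        gcongr
        · exact f.norm_coe_le_norm a
        · exact g.norm_coe_le_norm b
    _ < ε := by
        have : (‖f‖ + ‖g‖ + 1) * (ε / (‖f‖ + ‖g‖ + 1)) = ε := by field_simp
        nlinarith

end Functions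

section Holomorphic

variable {X : Type u} [NormedAddCommGroup X] [NormedSpace ℂ X]

/-- `f` is holomorphic on `B`: around each point of `B` it is the sum of a power series whose
terms are continuous homogeneous polynomials. -/
def IsHolomorphic (f : unitBall X →ᵇ ℂ) : Prop :=
  AnalyticOnNhd ℂ (extendZero f) (unitBall X)

theorem isHolomorphic_of_eq {f : unitBall X →ᵇ ℂ} {F : X → ℂ}
    (hF : AnalyticOnNhd ℂ F (unitBall X)) (h : ∀ x : unitBall X, f x = F x) :
    IsHolomorphic f :=
  hF.congr isOpen_ball fun x hx => by
    rw [extendZero_apply f ⟨x, hx⟩]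
    exact (h ⟨x, hx⟩).symm

variable (X) in
/-- `H^∞(B)`: the algebra of bounded holomorphic functions on `B`, inside the Banach algebra of
bounded continuous functions on `B` with the supremum norm. -/
def Hinf : Subalgebra ℂ (unitBall X →ᵇ ℂ) where
  carrier := {f | IsHolomorphic f}
  mul_mem' {f g} hf hg := isHolomorphic_of_eq (AnalyticOnNhd.mul hf hg) fun x => by
    simp [extendZero_apply]
  add_mem' {f g} hf hg := isHolomorphic_of_eq (AnalyticOnNhd.add hf hg) fun x => by
    simp [extendZero_apply]
  algebraMap_mem' c := isHolomorphic_of_eq (F := fun _ => c) analyticOnNhd_const fun _ => rfl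

variable (X) in
/-- `A_u(B)`: the algebra of uniformly continuous (bounded) holomorphic functions on `B`. -/
def Au : Subalgebra ℂ (unitBall X →ᵇ ℂ) where
  carrier := {f | IsHolomorphic f ∧ UniformContinuous f}
  mul_mem' hf hg := ⟨(Hinf X).mul_mem hf.1 hg.1, uniformContinuous_mul hf.2 hg.2⟩
  add_mem' hf hg := ⟨(Hinf X).add_mem hf.1 hg.1, hf.2.add hg.2⟩
  algebraMap_mem' c := ⟨(Hinf X).algebraMap_mem c, uniformContinuous_const⟩

end Holomorphic

section AronBerner

variable {X : Type u} [NormedAddCommGroup X] [NormedSpace ℂ X]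

/-- The Arens extension of a continuous `n`-linear form `A` on `X` to `X**`. One variable at a
time, starting with the last one, a form that is linear and continuous on `X` in this variable
is extended to `X**` by weak-star continuity: the extension of `ℓ ∈ X*` sends `z` to `z ℓ`. -/
def arensExt : (n : ℕ) → (X [×n]→L[ℂ] ℂ) → (Fin n → Bidual X) → ℂ
  | 0, A, _ => A 0
  | n + 1, A, z =>
      arensExt n ((z (Fin.last n)).compContinuousMultilinearMap A.curryRight)
        (fun i => z i.castSucc)

variable (X) in
/-- A continuous polynomial `P = P₀ + ⋯ + P_N` on `X`, given by the symmetric continuous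
`n`-linear forms associated to its homogeneous parts (which `P` determines by polarization). -/
structure ContPoly where
  /-- a bound `N` for the degree -/
  deg : ℕ
  /-- the `n`-linear form associated to the `n`-homogeneous part, for `n ≤ N` -/
  form : (n : ℕ) → X [×n]→L[ℂ] ℂ
  symm : ∀ (n : ℕ) (σ : Equiv.Perm (Fin n)) (v : Fin n → X), form n (v ∘ σ) = form n v

/-- The value `P x`. -/
def ContPoly.eval (P : ContPoly X) (x : X) : ℂ :=
  ∑ n ∈ Finset.range (P.deg + 1), P.form n (fun _ => x)

/-- The Aron-Berner extension of `P` to `X**`: the Arens extensions of the symmetric forms,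
restricted to the diagonal. -/
def ContPoly.aronBerner (P : ContPoly X) (z : Bidual X) : ℂ :=
  ∑ n ∈ Finset.range (P.deg + 1), arensExt n (P.form n) (fun _ => z)

/-- The symmetric `n`-linear form of the `n`-th Taylor polynomial of `f` at the origin. -/
def taylorForm (f : unitBall X →ᵇ ℂ) (n : ℕ) : X [×n]→L[ℂ] ℂ :=
  ((n.factorial : ℂ)⁻¹) • iteratedFDeriv ℂ n (extendZero f) 0

/-- `G` is, on the closed unit ball of `X**`, the Aron-Berner extension of `g`: on the open unit
ball it is the sum of the Aron-Berner extensions of the Taylor polynomials of `g` at the origin,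
and it is continuous up to the boundary. This determines `G` on the closed ball. -/
def IsAronBernerExt (g : unitBall X →ᵇ ℂ) (G : Bidual X → ℂ) : Prop :=
  (∀ z ∈ ball (0 : Bidual X) 1,
    HasSum (fun n : ℕ => arensExt n (taylorForm g n) (fun _ => z)) (G z)) ∧
  ContinuousOn G (closedBall (0 : Bidual X) 1)

end AronBerner

section Cluster

variable {X : Type u} [NormedAddCommGroup X] [NormedSpace ℂ X]

/-- The polynomial cluster set of `f` at `z`: the limits of `f (x α)` along the nets `(x α)` in
`B` that converge to `z` in the polynomial-star topology. -/
def polyClusterSet (f : unitBall X →ᵇ ℂ) (z : Bidual X) : Set ℂ :=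
  {c | ∃ (ι : Type u) (_ : Preorder ι) (_ : IsDirectedOrder ι) (_ : Nonempty ι)
      (x : ι → unitBall X),
    (∀ P : ContPoly X, Tendsto (fun α => P.eval (x α : X)) atTop (𝓝 (P.aronBerner z))) ∧
    Tendsto (fun α => f (x α)) atTop (𝓝 c)}

/-- The restriction map from the spectrum of `H` to the spectrum of `A_u(B)`, for `A_u(B) ⊆ H`. -/
def restrictAu (H : Subalgebra ℂ (unitBall X →ᵇ ℂ)) (hH : Au X ≤ H)
    (τ : WeakDual.characterSpace ℂ H) : WeakDual.characterSpace ℂ (Au X) :=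
  ⟨StrongDual.toWeakDual
      { toFun := fun g => τ (Subalgebra.inclusion hH g)
        map_add' := fun a b => by simp
        map_smul' := fun c a => by simp
        cont := (map_continuous τ).comp (continuous_inclusion hH) },
    by
      constructor
      · intro h
        have h1 : τ (Subalgebra.inclusion hH 1) = 0 := DFunLike.congr_fun h 1
        simp at h1
      · intro a b
        change τ (Subalgebra.inclusion hH (a * b)) =
          τ (Subalgebra.inclusion hH a) * τ (Subalgebra.inclusion hH b)
        rw [map_mul, map_mul]⟩

theorem restrictAu_apply (H : Subalgebra ℂ (unitBall X →ᵇ ℂ)) (hH : Au X ≤ H)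
    (τ : WeakDual.characterSpace ℂ H) (g : Au X) :
    restrictAu H hH τ g = τ (Subalgebra.inclusion hH g) := rfl

/-- The character `φ` of `A_u(B)` is `δ_z`: it evaluates the Aron-Berner extension of every
`g ∈ A_u(B)` at the point `z` of the closed unit ball of `X**`. -/
def IsEvalAt (z : Bidual X) (φ : WeakDual.characterSpace ℂ (Au X)) : Prop :=
  ∀ g : Au X, ∃ G : Bidual X → ℂ, IsAronBernerExt (g : unitBall X →ᵇ ℂ) G ∧ φ g = G z

/-- The polynomial fiber of the spectrum of `H` at `z`: the characters of `H` that restrict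
to `δ_z` on `A_u(B)`. -/
def polyFiber (H : Subalgebra ℂ (unitBall X →ᵇ ℂ)) (hH : Au X ≤ H) (z : Bidual X) :
    Set (WeakDual.characterSpace ℂ H) :=
  {τ | IsEvalAt z (restrictAu H hH τ)}

end Cluster

end PolyCluster

end

namespace PolyCluster

universe u

set_option maxSynthPendingDepth 3

variable {X : Type u} [NormedAddCommGroup X] [NormedSpace ℂ X]

/-! The spectrum of `H` is compact, so along an ultrafilter refining the given net the evaluation
characters at the points of the net converge to some `τ`, and `τ h` is the limit of the values of
`h` for every `h` in `H`. In particular `τ f` is the given cluster value. It remains to see that `τ`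
lies in the fiber, i.e. that polynomial-star convergence to a point forces each `g ∈ A_u(B)` to
converge to the value of its Aron-Berner extension there (`exists_isAronBernerExt`).

For this, `g` is a uniform limit on `B` of Taylor polynomials of its dilations
(`norm_dilatedTaylor_sub_le`). Davie-Gamelin density (`exists_norm_form_sub_arensExt_lt`,
`exists_filter_tendsto_aronBerner`) carries estimates from `B` to the closed bidual ball: the
extended polynomials converge uniformly there, and the Cauchy bounds on the Taylor terms survive,
which identifies the limit with the Aron-Berner series on the open ball. -/

/-! ### Polynomial-star density of the ball in the closed bidual ball. -/

/-- Goldstine's theorem, for finitely many functionals. -/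
theorem exists_mem_ball_norm_sub_lt {κ : Type*} [Finite κ] (ℓ : κ → StrongDual ℂ X)
    {z : Bidual X} (hz : ‖z‖ ≤ 1) {ε : ℝ} (hε : 0 < ε) :
    ∃ x : X, ‖x‖ < 1 ∧ ∀ k, ‖ℓ k x - z (ℓ k)‖ < ε := by
  classical
  have := Fintype.ofFinite κ
  let T : X →L[ℂ] (κ → ℂ) := ContinuousLinearMap.pi ℓ
  suffices h : (fun k => z (ℓ k)) ∈ closure (T '' ball (0 : X) 1) by
    obtain ⟨_, ⟨x, hx, rfl⟩, hd⟩ := Metric.mem_closure_iff.1 h ε hε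
    refine ⟨x, by simpa using hx, fun k => ?_⟩
    rw [← dist_eq_norm, dist_comm]
    exact (dist_le_pi_dist _ _ k).trans_lt hd
  -- A functional separating the point from the closed convex set pulls back to some `ψ` on `X` with
  -- `‖ψ‖ ≤ -s`, while the real part of `z ψ` lies below `s`; this contradicts `‖z‖ ≤ 1`.
  by_contra hp
  have hconv : Convex ℝ (closure (T '' ball (0 : X) 1)) :=
    ((convex_ball (0 : X) 1).linear_image (T.restrictScalars ℝ).toLinearMap).closure
  obtain ⟨F, s, hF₁, hF₂⟩ :=
    RCLike.geometric_hahn_banach_point_closed (𝕜 := ℂ) hconv isClosed_closure hp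
  have hF : ∀ v : κ → ℂ, F v = ∑ k, F (Pi.single k 1) * v k := fun v => by
    conv_lhs => rw [pi_eq_sum_univ' v, map_sum]
    refine Finset.sum_congr rfl fun k _ => ?_
    rw [map_smul, smul_eq_mul, mul_comm]
  set ψ : StrongDual ℂ X := ∑ k, F (Pi.single k 1) • ℓ k with hψ
  have hψx : ∀ x, F (T x) = ψ x := fun x => by
    rw [hF]; simp [hψ, T]
  have hψz : F (fun k => z (ℓ k)) = z ψ := by
    rw [hF]; simp [hψ]
  have hb : ∀ x : X, ‖x‖ < 1 → s < (ψ x).re := fun x hx => by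
    have := hF₂ (T x) (subset_closure ⟨x, by simpa using hx, rfl⟩)
    rwa [hψx] at this
  have hs : s < 0 := by simpa using hb 0 (by simp)
  have hn : ∀ x : X, ‖x‖ < 1 → ‖ψ x‖ ≤ -s := fun x hx => by
    obtain ⟨c, hc, hc'⟩ := Complex.exists_norm_mul_eq_self (ψ x)
    have hc0 : c ≠ 0 := by rintro rfl; simp at hc
    -- Rotating `x` makes the value of `ψ` equal to `-‖ψ x‖`, so the bound on real parts becomes a
    -- bound on the modulus.
    have h1 := hb (-c⁻¹ • x) (by rw [norm_smul]; simpa [hc] using hx)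
    have h2 : ψ (-c⁻¹ • x) = -(‖ψ x‖ : ℂ) := by
      rw [map_smul, smul_eq_mul]
      nth_rewrite 1 [← hc']
      field_simp
    rw [h2] at h1
    simp at h1
    linarith
  have hψn : ‖ψ‖ ≤ -s :=
    by
    refine ContinuousLinearMap.opNorm_le_of_unit_norm (by linarith) fun x hx => ?_
    have hcl : closure (ball (0 : X) 1) ⊆ {x | ‖ψ x‖ ≤ -s} :=
      closure_minimal (fun x hx => hn x (by simpa using hx))
        (isClosed_le (by fun_prop) continuous_const)
    rw [closure_ball _ one_ne_zero] at hcl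
    exact hcl (by simp [hx])
  have h3 : ‖z ψ‖ ≤ ‖ψ‖ := (z.le_opNorm ψ).trans (by nlinarith [norm_nonneg ψ])
  have h4 := hF₁
  rw [hψz] at h4
  have h5 := Complex.abs_re_le_norm (z ψ)
  have h6 := neg_abs_le (z ψ).re
  simp at h4
  linarith

/-- The Arens extension of `A` at the diagonal point `z, …, z`, decomposed into successive
evaluations at `z` in the last variable. -/
theorem exists_arensExt_chain (z : Bidual X) (n : ℕ) (A : X [×n]→L[ℂ] ℂ) :
    ∃ C : ∀ j, X [×j]→L[ℂ] ℂ, C n = A ∧ (∀ j < n, ∀ v, C j v = z ((C (j + 1)).curryRight v)) ∧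
      C 0 0 = arensExt n A fun _ => z := by
  induction n with
  | zero => exact ⟨fun j => if h : j = 0 then h ▸ A else 0, by simp, by simp, rfl⟩
  | succ n ih =>
    obtain ⟨C, h₁, h₂, h₃⟩ := ih (z.compContinuousMultilinearMap A.curryRight)
    refine ⟨Function.update C (n + 1) A, by simp, fun j hj v => ?_, ?_⟩
    · rw [Function.update_of_ne hj.ne]
      rcases (Nat.lt_succ_iff.1 hj).eq_or_lt with rfl | hj'
      · rw [Function.update_self, h₁]; rfl
      · rw [Function.update_of_ne (by omega), h₂ j hj']
    · rw [Function.update_of_ne (by omega), h₃]; rfl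

/-- The points are chosen inductively. Each new one imitates `z`, by Goldstine, on the finitely many
functionals obtained by filling the other variables with earlier points. Along increasing indices
the last variable is the newest point, so peeling off variables from the right costs `ε` each. -/
theorem exists_seq_norm_sub_le {ι : Type*} [Finite ι] (n : ι → ℕ)
    (C : ι → ∀ j, X [×j]→L[ℂ] ℂ) {z : Bidual X} (hz : ‖z‖ ≤ 1)
    (hC : ∀ i, ∀ j < n i, ∀ v, C i j v = z ((C i (j + 1)).curryRight v))
    {ε : ℝ} (hε : 0 < ε) (m : ℕ) :
    ∃ x : ℕ → X, (∀ k, ‖x k‖ < 1) ∧ ∀ i, ∀ j ≤ n i, ∀ f : Fin j → ℕ, StrictMono f →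
      (∀ t, f t < m) → ‖C i j (x ∘ f) - C i 0 0‖ ≤ j * ε := by
  have h0 : ∀ (x : ℕ → X) (i) (f : Fin 0 → ℕ), ‖C i 0 (x ∘ f) - C i 0 0‖ ≤ (0 : ℕ) * ε := by
    intro x i f
    rw [Subsingleton.elim (x ∘ f) 0]; simp
  induction m with
  | zero =>
    refine ⟨fun _ => 0, by simp, fun i j _ f _ hf => ?_⟩
    cases j with
    | zero => exact h0 _ i f
    | succ j => exact absurd (hf 0) (by simp)
  | succ m ih =>
    obtain ⟨x, hx, h⟩ := ih
    obtain ⟨y, hy, hy'⟩ := exists_mem_ball_norm_sub_lt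
      (κ := Σ i : ι, Σ j : Fin (n i), (Fin j → Fin m))
      (fun k => (C k.1 (k.2.1 + 1)).curryRight fun t => x (k.2.2 t)) hz hε
    have hupd : ∀ {j : ℕ} (f : Fin j → ℕ), (∀ t, f t < m) →
        Function.update x m y ∘ f = x ∘ f := fun f hf => by
      ext t
      simp [Function.update_of_ne (hf t).ne]
    refine ⟨Function.update x m y, fun k => ?_, fun i j hj f hf hfm => ?_⟩
    · rcases eq_or_ne k m with rfl | hk
      · simpa using hy
      · simpa [Function.update_of_ne hk] using hx k
    · cases j with
      | zero => exact h0 _ i f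
      | succ j =>
        by_cases hl : f (Fin.last j) < m
        · have hlt : ∀ t, f t < m := fun t => (hf.monotone (Fin.le_last t)).trans_lt hl
          rw [hupd f hlt]
          exact h i _ hj f hf hlt
        · have hl' : f (Fin.last j) = m := by have := hfm (Fin.last j); omega
          have hg : ∀ t : Fin j, f t.castSucc < m := fun t =>
            (hf (Fin.castSucc_lt_last t)).trans_eq hl'
          have e : Function.update x m y ∘ f =
              Fin.snoc (α := fun _ => X) (fun t : Fin j => x (f t.castSucc)) y := by
            ext t
            refine Fin.lastCases ?_ (fun t => ?_) t
            · simp [hl']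
            · simp [Function.update_of_ne (hg t).ne]
          have h1 := hy' ⟨i, ⟨j, hj⟩, fun t => ⟨f t.castSucc, hg t⟩⟩
          have h2 := h i j (Nat.le_of_succ_le hj) (fun t => f t.castSucc)
            (hf.comp (Fin.strictMono_castSucc)) hg
          simp only at h1
          rw [← hC i j hj, ContinuousMultilinearMap.curryRight_apply] at h1
          rw [e]
          push_cast
          have h3 := norm_sub_le_norm_sub_add_norm_sub
            (C i (j + 1) (Fin.snoc (α := fun _ => X) (fun t : Fin j => x (f t.castSucc)) y))
            (C i j fun t => x (f t.castSucc)) (C i 0 0)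
          have h4 : ‖(C i j fun t => x (f t.castSucc)) - C i 0 0‖ ≤ j * ε := h2
          linarith

/-- Averaging passes from distinct arguments to the diagonal. Multilinearity expands the value at
the average over all index tuples; symmetry sorts the injective ones into increasing order, and the
others form a proportion `1 - m.descFactorial n / m ^ n`, which is negligible for large `m`. -/
theorem norm_map_average_sub_le {n : ℕ} (A : X [×n]→L[ℂ] ℂ)
    (hA : ∀ (σ : Equiv.Perm (Fin n)) (v : Fin n → X), A (v ∘ σ) = A v) (w : ℂ) {ε : ℝ}
    (hε : 0 ≤ ε) {m : ℕ} (hm : 0 < m) (x : ℕ → X) (hx : ∀ k, ‖x k‖ ≤ 1)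
    (h : ∀ f : Fin n → ℕ, StrictMono f → (∀ t, f t < m) → ‖A (x ∘ f) - w‖ ≤ ε) :
    ‖A (fun _ => (m : ℂ)⁻¹ • ∑ k : Fin m, x k) - w‖ ≤
      ε + (1 - (m.descFactorial n : ℝ) / m ^ n) * (‖A‖ + ‖w‖) := by
  classical
  have hm' : (m : ℂ) ≠ 0 := by exact_mod_cast hm.ne'
  have hmR : (0 : ℝ) < m := by exact_mod_cast hm
  have e1 : A (fun _ => (m : ℂ)⁻¹ • ∑ k : Fin m, x k) - w =
      ((m : ℂ) ^ n)⁻¹ * ∑ f : Fin n → Fin m, (A (fun t => x (f t)) - w) := by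
    rw [Finset.sum_sub_distrib, ← ContinuousMultilinearMap.map_sum A
      (fun (_ : Fin n) (k : Fin m) => x k), A.map_smul_univ (fun _ => (m : ℂ)⁻¹)]
    simp [mul_sub, hm']
  have hterm : ∀ f : Fin n → Fin m, ‖A (fun t => x (f t)) - w‖ ≤
      ε + if Function.Injective f then 0 else ‖A‖ + ‖w‖ := by
    intro f
    split_ifs with hf
    · have hs : StrictMono (fun t => (f (Tuple.sort f t) : ℕ)) :=
        ((Tuple.monotone_sort f).strictMono_of_injective
          (hf.comp (Tuple.sort f).injective))
      have := h _ hs fun t => (f _).2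
      rw [add_zero, ← hA (Tuple.sort f)]
      exact this
    · have h1 : ‖A (fun t => x (f t))‖ ≤ ‖A‖ := by
        refine (A.le_opNorm _).trans (mul_le_of_le_one_right (norm_nonneg _) ?_)
        exact Finset.prod_le_one (fun _ _ => norm_nonneg _) fun _ _ => hx _
      have := norm_sub_le (A (fun t => x (f t))) w
      linarith
  have hcard : ((Finset.univ.filter fun f : Fin n → Fin m => ¬ Function.Injective f).card : ℝ) =
      m ^ n - m.descFactorial n := by
    have h1 : (Finset.univ.filter fun f : Fin n → Fin m => Function.Injective f).card =
        m.descFactorial n := by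
      rw [← Fintype.card_subtype, Fintype.card_congr
        (Equiv.subtypeInjectiveEquivEmbedding (Fin n) (Fin m)), Fintype.card_embedding_eq]
      simp
    have h2 := Finset.card_filter_add_card_filter_not (s := (Finset.univ : Finset (Fin n → Fin m)))
      (fun f => Function.Injective f)
    rw [h1, Finset.card_univ] at h2
    simp only [Fintype.card_fun, Fintype.card_fin] at h2
    rw [eq_sub_iff_add_eq']
    exact_mod_cast h2
  have hsum : ‖∑ f : Fin n → Fin m, (A (fun t => x (f t)) - w)‖ ≤
      m ^ n * ε + (m ^ n - m.descFactorial n) * (‖A‖ + ‖w‖) := by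
    refine (norm_sum_le_of_le _ fun f _ => hterm f).trans_eq ?_
    rw [Finset.sum_add_distrib, Finset.sum_ite, ← hcard]
    simp [mul_add]
  rw [e1, norm_mul, norm_inv, norm_pow, Complex.norm_natCast, inv_mul_le_iff₀ (by positivity)]
  refine hsum.trans_eq ?_
  field_simp

theorem tendsto_descFactorial_div_pow (n : ℕ) :
    Tendsto (fun m : ℕ => (m.descFactorial n : ℝ) / m ^ n) atTop (𝓝 1) := by
  refine (Asymptotics.isEquivalent_iff_tendsto_one ?_).1 (isEquivalent_descFactorial n)
  filter_upwards [eventually_gt_atTop 0] with m hm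
  positivity

/-- Davie and Gamelin: the points of the closed unit ball of the bidual are limits of points of
the unit ball, in the sense of the values of finitely many homogeneous polynomials. -/
theorem exists_norm_form_sub_arensExt_lt {ι : Type*} [Finite ι] (n : ι → ℕ)
    (A : ∀ i, X [×(n i)]→L[ℂ] ℂ)
    (hA : ∀ i (σ : Equiv.Perm (Fin (n i))) (v : Fin (n i) → X), A i (v ∘ σ) = A i v)
    {z : Bidual X} (hz : ‖z‖ ≤ 1) {ε : ℝ} (hε : 0 < ε) :
    ∃ x : X, ‖x‖ < 1 ∧ ∀ i, ‖A i (fun _ => x) - arensExt (n i) (A i) fun _ => z‖ < ε := by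
  choose C hC₁ hC₂ hC₃ using fun i => exists_arensExt_chain z (n i) (A i)
  have hlim : ∀ i, Tendsto (fun m : ℕ => ε / 2 + (1 - (m.descFactorial (n i) : ℝ) / m ^ (n i)) *
      (‖A i‖ + ‖arensExt (n i) (A i) fun _ => z‖)) atTop (𝓝 (ε / 2 + (1 - 1) *
      (‖A i‖ + ‖arensExt (n i) (A i) fun _ => z‖))) := fun i =>
    (((tendsto_descFactorial_div_pow (n i)).const_sub 1).mul_const _).const_add _
  have hev := (eventually_all.2 fun i => (hlim i).eventually (gt_mem_nhds
    (show _ < ε by linarith))).and (eventually_gt_atTop 0)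
  obtain ⟨m, hm, hm0⟩ := hev.exists
  obtain ⟨N, hN⟩ : ∃ N : ℕ, ∀ i, n i ≤ N := by
    obtain ⟨N, hN⟩ := (Set.finite_range n).bddAbove
    exact ⟨N, fun i => hN ⟨i, rfl⟩⟩
  obtain ⟨x, hx, h⟩ := exists_seq_norm_sub_le n C hz hC₂
    (show 0 < ε / (2 * (N + 1)) by positivity) m
  refine ⟨(m : ℂ)⁻¹ • ∑ k : Fin m, x k, ?_, fun i => ?_⟩
  · have : NeZero m := ⟨hm0.ne'⟩
    rw [norm_smul, norm_inv, Complex.norm_natCast, inv_mul_lt_iff₀ (by exact_mod_cast hm0)]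
    calc ‖∑ k : Fin m, x k‖ ≤ ∑ k : Fin m, ‖x k‖ := norm_sum_le _ _
      _ < ∑ k : Fin m, (1 : ℝ) :=
        Finset.sum_lt_sum_of_nonempty Finset.univ_nonempty fun k _ => hx k
      _ = m * 1 := by simp
  · refine (norm_map_average_sub_le (A i) (hA i) _ (half_pos hε).le hm0 x
      (fun k => (hx k).le) fun f hf hfm => ?_).trans_lt (hm i)
    have h1 := h i (n i) le_rfl f hf hfm
    rw [hC₁, hC₃] at h1
    refine h1.trans ?_
    have : (n i : ℝ) ≤ N := by exact_mod_cast hN i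
    calc (n i : ℝ) * (ε / (2 * (N + 1))) ≤ (N + 1) * (ε / (2 * (N + 1))) := by
          gcongr; linarith
      _ = ε / 2 := by field_simp

/-- Davie and Gamelin: the unit ball is dense in the closed unit ball of the bidual for the
polynomial-star topology. -/
theorem exists_filter_tendsto_aronBerner {z : Bidual X} (hz : ‖z‖ ≤ 1) :
    ∃ l : Filter (unitBall X), l.NeBot ∧
      ∀ P : ContPoly X, Tendsto (fun x : unitBall X => P.eval x) l (𝓝 (P.aronBerner z)) := by
  let T : unitBall X → (Σ _ : ContPoly X, ℕ) → ℂ := fun x i => i.1.form i.2 fun _ => x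
  let p : (Σ _ : ContPoly X, ℕ) → ℂ := fun i => arensExt i.2 (i.1.form i.2) fun _ => z
  refine ⟨comap T (𝓝 p), ?_, fun P => ?_⟩
  · refine comap_neBot fun t ht => ?_
    -- A basic neighbourhood in the product constrains only finitely many coordinates, so finite
    -- approximation suffices.
    rw [nhds_pi, Filter.mem_pi] at ht
    obtain ⟨I, hI, s, hs, hst⟩ := ht
    have hev : ∀ᶠ ε : ℝ in 𝓝[>] 0, ∀ i ∈ I, ball (p i) ε ⊆ s i := by
      refine (eventually_all_finite hI).2 fun i _ => ?_
      obtain ⟨δ, hδ, hδs⟩ := Metric.mem_nhds_iff.1 (hs i)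
      filter_upwards [Ioo_mem_nhdsGT hδ] with ε hε
      exact (ball_subset_ball hε.2.le).trans hδs
    obtain ⟨ε, hε, hε0⟩ := (hev.and self_mem_nhdsWithin).exists
    have := hI.to_subtype
    obtain ⟨x, hx, h⟩ := exists_norm_form_sub_arensExt_lt (fun i : I => i.1.2)
      (fun i => i.1.1.form i.1.2) (fun i => i.1.1.symm i.1.2) hz hε0
    exact ⟨⟨x, by simpa using hx⟩, hst fun i hi => hε i hi (by
      simpa [T, p, dist_eq_norm] using h ⟨i, hi⟩)⟩
  · refine tendsto_finsetSum _ fun n _ => ?_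
    exact ((continuous_apply (⟨P, n⟩ : Σ _ : ContPoly X, ℕ)).tendsto p).comp tendsto_comap

/-! ### Continuity and homogeneity of the Arens extension. -/

theorem continuous_arensExt (n : ℕ) :
    Continuous fun p : (X [×n]→L[ℂ] ℂ) × (Fin n → Bidual X) => arensExt n p.1 p.2 := by
  induction n with
  | zero =>
    exact (ContinuousMultilinearMap.apply ℂ (fun _ : Fin 0 => X) ℂ 0).continuous.comp
      continuous_fst
  | succ n ih =>
    refine ih.comp (Continuous.prodMk ?_ (by fun_prop))
    have h := (isBoundedBilinearMap_compMultilinear (𝕜 := ℂ) (E := fun _ : Fin n => X)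
      (F := StrongDual ℂ X) (G := ℂ)).continuous
    refine h.comp (f := fun p : (X [×(n + 1)]→L[ℂ] ℂ) × (Fin (n + 1) → Bidual X) =>
      (p.2 (Fin.last n), p.1.curryRight)) (Continuous.prodMk (by fun_prop) ?_)
    exact (continuousMultilinearCurryRightEquiv' ℂ n X ℂ).continuous.comp continuous_fst

theorem arensExt_smul (n : ℕ) (c : ℂ) (A : X [×n]→L[ℂ] ℂ) (z : Fin n → Bidual X) :
    arensExt n (c • A) z = c * arensExt n A z := by
  induction n with
  | zero => rfl
  | succ n ih =>
    have h : (z (Fin.last n)).compContinuousMultilinearMap (c • A).curryRight =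
        c • (z (Fin.last n)).compContinuousMultilinearMap A.curryRight := by
      ext v
      change z (Fin.last n) (c • A.curryRight v) = c • z (Fin.last n) (A.curryRight v)
      rw [map_smul]
    rw [arensExt, h, ih]; rfl

theorem arensExt_diag_smul (n : ℕ) (c : ℂ) (A : X [×n]→L[ℂ] ℂ) (z : Bidual X) :
    arensExt n A (fun _ => c • z) = c ^ n * arensExt n A fun _ => z := by
  induction n with
  | zero => simp [arensExt]
  | succ n ih =>
    have h : (c • z).compContinuousMultilinearMap A.curryRight =
        c • z.compContinuousMultilinearMap A.curryRight := by
      ext v; rfl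
    rw [arensExt, arensExt, h, ih, arensExt_smul, pow_succ, mul_assoc]

theorem ContPoly.continuous_aronBerner (P : ContPoly X) : Continuous P.aronBerner :=
  continuous_finsetSum _ fun n _ =>
    (continuous_arensExt n).comp (continuous_const.prodMk (by fun_prop))

/-! ### Taylor polynomials at the origin and their Aron-Berner extensions. -/

section Taylor

variable {f : unitBall X →ᵇ ℂ}

theorem taylorForm_symm (hf : IsHolomorphic f) (n : ℕ) (σ : Equiv.Perm (Fin n)) (v : Fin n → X) :
    taylorForm f n (v ∘ σ) = taylorForm f n v := by
  simp only [taylorForm, _root_.smul_apply]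
  rw [(hf 0 (by simp)).contDiffAt.iteratedFDeriv_comp_perm]

theorem iteratedDeriv_extendZero_line [CompleteSpace X] (hf : IsHolomorphic f) (x : X) (n : ℕ) :
    iteratedDeriv n (fun t : ℂ => extendZero f (t • x)) 0 =
      iteratedFDeriv ℂ n (extendZero f) 0 fun _ => x := by
  let L : ℂ →L[ℂ] X := ContinuousLinearMap.toSpanSingleton ℂ x
  have ho : IsOpen (L ⁻¹' unitBall X) := isOpen_ball.preimage L.continuous
  have h := L.iteratedFDerivWithin_comp_right (n := ⊤) (i := n) (hf.contDiffOn isOpen_ball.uniqueDiffOn)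
    isOpen_ball.uniqueDiffOn ho.uniqueDiffOn (x := 0) (by simp) (by simp)
  rw [iteratedFDerivWithin_of_isOpen n ho (by simp),
    iteratedFDerivWithin_of_isOpen n isOpen_ball (by simp)] at h
  rw [iteratedDeriv_eq_iteratedFDeriv]
  have h' := congrArg (fun A => A fun _ => (1 : ℂ)) h
  simpa [L, Function.comp_def] using h'

theorem differentiableOn_extendZero_line (hf : IsHolomorphic f) (x : X) :
    DifferentiableOn ℂ (fun t : ℂ => extendZero f (t • x)) {t | ‖t • x‖ < 1} := by
  refine hf.differentiableOn.comp (by fun_prop) fun t ht => ?_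
  simpa using ht

/-- Cauchy's estimate on the unit circle for the one-variable function `t ↦ f (t x)`. -/
theorem norm_taylorForm_diag_le [CompleteSpace X] (hf : IsHolomorphic f) (n : ℕ) {x : X}
    (hx : ‖x‖ < 1) : ‖taylorForm f n fun _ => x‖ ≤ ‖f‖ := by
  have hsub : ∀ t ∈ closedBall (0 : ℂ) 1, ‖t • x‖ < 1 := fun t ht => by
    rw [norm_smul]
    have : ‖t‖ ≤ 1 := by simpa using ht
    nlinarith [norm_nonneg x, norm_nonneg t]
  have hd : DiffContOnCl ℂ (fun t : ℂ => extendZero f (t • x)) (ball 0 1) :=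
    DifferentiableOn.diffContOnCl <| (differentiableOn_extendZero_line hf x).mono fun t ht =>
      hsub t (closure_ball_subset_closedBall ht)
  have h := Complex.norm_iteratedDeriv_le_of_forall_mem_sphere_norm_le n one_pos hd (C := ‖f‖)
    fun t ht => by
      rw [extendZero_apply f ⟨t • x, by simpa using hsub t (sphere_subset_closedBall ht)⟩]
      exact f.norm_coe_le_norm _
  rw [iteratedDeriv_extendZero_line hf] at h
  simp only [taylorForm, _root_.smul_apply, norm_smul, norm_inv,
    Complex.norm_natCast]
  rw [inv_mul_le_iff₀ (by positivity)]
  simpa using h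

theorem hasSum_taylorForm [CompleteSpace X] (hf : IsHolomorphic f) (x : unitBall X) {t : ℂ}
    (ht : ‖t‖ < 1) :
    HasSum (fun n => t ^ n * taylorForm f n fun _ => x) (extendZero f (t • (x : X))) := by
  have hx : ‖(x : X)‖ < 1 := mem_ball_zero_iff.1 x.2
  have hd : DifferentiableOn ℂ (fun t : ℂ => extendZero f (t • (x : X))) (ball 0 1) :=
    (differentiableOn_extendZero_line hf x).mono fun t ht => by
      have : ‖t‖ < 1 := by simpa using ht
      rw [Set.mem_ofPred_eq, norm_smul]
      nlinarith [norm_nonneg (x : X), norm_nonneg t]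
  refine (Complex.hasSum_taylorSeries_on_ball hd (z := t) (by simpa using ht)).congr_fun ?_
  intro n
  rw [iteratedDeriv_extendZero_line hf]
  simp [taylorForm]
  ring

/-- The Taylor polynomial of degree `N` of `x ↦ f (r x)`. -/
noncomputable def dilatedTaylor (hf : IsHolomorphic f) (r : ℝ) (N : ℕ) : ContPoly X where
  deg := N
  form n := (r : ℂ) ^ n • taylorForm f n
  symm n σ v := by
    simp only [_root_.smul_apply]
    rw [taylorForm_symm hf]

/-- Uniform continuity makes `f (r x)` close to `f x` for `r` near `1`; for fixed `r < 1` the Cauchy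
estimates give the Taylor series of `f (r x)` a geometric tail independent of `x`. -/
theorem norm_dilatedTaylor_sub_le [CompleteSpace X] (hf : IsHolomorphic f)
    (hu : UniformContinuous f) {ε : ℝ} (hε : 0 < ε) :
    ∀ᶠ r in 𝓝[<] (1 : ℝ), ∀ᶠ N in atTop, ∀ x : unitBall X,
      ‖(dilatedTaylor hf r N).eval x - f x‖ ≤ ε := by
  obtain ⟨δ, hδ, h⟩ := Metric.uniformContinuous_iff.1 hu (ε / 2) (half_pos hε)
  filter_upwards [Ioo_mem_nhdsLT (show max 0 (1 - δ) < 1 by simp [hδ])] with r hr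
  have hr0 : 0 < r := (le_max_left _ _).trans_lt hr.1
  have hr1 : 1 - δ < r := (le_max_right _ _).trans_lt hr.1
  have hlim : Tendsto (fun N : ℕ => ‖f‖ * r ^ (N + 1) / (1 - r)) atTop (𝓝 0) := by
    have := ((tendsto_pow_atTop_nhds_zero_of_lt_one hr0.le hr.2).comp
      (tendsto_add_atTop_nat 1)).const_mul ‖f‖ |>.div_const (1 - r)
    simpa using this
  filter_upwards [hlim.eventually (gt_mem_nhds (half_pos hε))] with N hN x
  have hx : ‖(x : X)‖ < 1 := mem_ball_zero_iff.1 x.2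
  have hrn : ‖(r : ℂ)‖ = r := by simp [abs_of_pos hr0]
  have hrx : ‖(r : ℂ) • (x : X)‖ < 1 := by
    rw [norm_smul, hrn]; nlinarith [norm_nonneg (x : X), hr.2]
  have hs := hasSum_taylorForm hf x (t := r) (by rw [hrn]; exact hr.2)
  have h1 := norm_sub_le_of_geometric_bound_of_hasSum hr.2 (C := ‖f‖) (fun n => by
    rw [norm_mul, norm_pow, hrn, mul_comm]
    gcongr
    exact norm_taylorForm_diag_le hf n hx) hs (N + 1)
  rw [extendZero_apply f ⟨(r : ℂ) • (x : X), by simpa using hrx⟩] at h1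
  have h2 : dist (f ⟨(r : ℂ) • (x : X), by simpa using hrx⟩) (f x) < ε / 2 := by
    refine h ?_
    rw [Subtype.dist_eq, dist_eq_norm]
    have e : (r : ℂ) • (x : X) - x = ((r - 1 : ℝ) : ℂ) • (x : X) := by
      push_cast; rw [sub_smul, one_smul]
    simp only [e, norm_smul, Complex.norm_real, Real.norm_eq_abs]
    rw [abs_sub_comm, abs_of_pos (by linarith [hr.2])]
    nlinarith [norm_nonneg (x : X), hr.2]
  rw [dist_eq_norm] at h2
  have h3 := norm_sub_le_norm_sub_add_norm_sub ((dilatedTaylor hf r N).eval x)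
    (f ⟨(r : ℂ) • (x : X), by simpa using hrx⟩) (f x)
  have h4 : (dilatedTaylor hf r N).eval x =
    ∑ n ∈ Finset.range (N + 1), (r : ℂ) ^ n * taylorForm f n fun _ => x := rfl
  rw [← h4] at h1
  linarith

/-- Density transfers the Cauchy estimate from `B` to the bidual. -/
theorem norm_arensExt_taylorForm_le [CompleteSpace X] (hf : IsHolomorphic f) (n : ℕ)
    {z : Bidual X} (hz : ‖z‖ ≤ 1) : ‖arensExt n (taylorForm f n) fun _ => z‖ ≤ ‖f‖ := by
  refine le_of_forall_pos_le_add fun ε hε => ?_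
  obtain ⟨x, hx, h⟩ := exists_norm_form_sub_arensExt_lt (ι := Unit) (fun _ => n)
    (fun _ => taylorForm f n) (fun _ => taylorForm_symm hf n) hz hε
  have h1 := norm_taylorForm_diag_le hf n hx
  have h2 := norm_sub_norm_le (arensExt n (taylorForm f n) fun _ => z) (taylorForm f n fun _ => x)
  have h3 := h ()
  rw [norm_sub_rev] at h3
  linarith

theorem norm_arensExt_taylorForm_le_pow [CompleteSpace X] (hf : IsHolomorphic f) (n : ℕ)
    {z : Bidual X} (hz : ‖z‖ ≤ 1) :
    ‖arensExt n (taylorForm f n) fun _ => z‖ ≤ ‖f‖ * ‖z‖ ^ n := by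
  rcases eq_or_ne z 0 with rfl | h0
  · cases n with
    | zero => simpa using norm_arensExt_taylorForm_le hf 0 hz
    | succ n =>
      have h := arensExt_diag_smul (n + 1) 0 (taylorForm f (n + 1)) (0 : Bidual X)
      rw [smul_zero, zero_pow n.succ_ne_zero, zero_mul] at h
      rw [h, norm_zero]
      positivity
  · have h0' : ‖z‖ ≠ 0 := (norm_pos_iff.2 h0).ne'
    have e : z = (‖z‖ : ℂ) • ((‖z‖ : ℂ)⁻¹ • z) := by
      rw [smul_inv_smul₀ (by exact_mod_cast h0')]
    have hw : ‖(‖z‖ : ℂ)⁻¹ • z‖ ≤ 1 := by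
      rw [norm_smul]; simp [h0']
    conv_lhs => rw [e]
    rw [arensExt_diag_smul, norm_mul, norm_pow, mul_comm]
    simp only [Complex.norm_real, norm_norm]
    gcongr
    exact norm_arensExt_taylorForm_le hf n hw

end Taylor

/-! ### Aron-Berner extension of functions in `A_u(B)`. -/

theorem exists_seq_dilatedTaylor [CompleteSpace X] {g : unitBall X →ᵇ ℂ}
    (hf : IsHolomorphic g) (hu : UniformContinuous g) :
    ∃ (r : ℕ → ℝ) (N : ℕ → ℕ), (∀ k, 0 < r k ∧ r k < 1) ∧ Tendsto r atTop (𝓝 1) ∧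
      Tendsto N atTop atTop ∧
      ∀ (k : ℕ) (x : unitBall X), ‖(dilatedTaylor hf (r k) (N k)).eval x - g x‖ ≤ 1 / (k + 1) := by
  have h : ∀ k : ℕ, ∃ (r : ℝ) (N : ℕ), r ∈ Set.Ioo (max 0 (1 - 1 / ((k : ℝ) + 1))) 1 ∧ k ≤ N ∧
      ∀ x : unitBall X, ‖(dilatedTaylor hf r N).eval x - g x‖ ≤ 1 / (k + 1) := fun k => by
    have hk : (0 : ℝ) < 1 / (k + 1) := by positivity
    obtain ⟨r, hr, hr'⟩ := ((norm_dilatedTaylor_sub_le hf hu hk).and (Ioo_mem_nhdsLT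
      (show max 0 (1 - 1 / ((k : ℝ) + 1)) < 1 from max_lt one_pos (by linarith)))).exists
    obtain ⟨N, hN, hN'⟩ := (hr.and (eventually_ge_atTop k)).exists
    exact ⟨r, N, hr', hN', hN⟩
  choose r N hr hN h using h
  refine ⟨r, N, fun k => ⟨(le_max_left _ _).trans_lt (hr k).1, (hr k).2⟩, ?_,
    tendsto_atTop_mono hN tendsto_id, h⟩
  refine tendsto_of_tendsto_of_tendsto_of_le_of_le (g := fun k : ℕ => 1 - 1 / ((k : ℝ) + 1))
    ?_ tendsto_const_nhds (fun k => ((le_max_right _ _).trans_lt (hr k).1).le) fun k => (hr k).2.le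
  simpa using (tendsto_one_div_add_atTop_nhds_zero_nat (𝕜 := ℝ)).const_sub 1

/-- Dominated convergence for series, with the geometric majorant `‖g‖ * ‖z‖ ^ n`. -/
theorem tendsto_aronBerner_dilatedTaylor [CompleteSpace X] {g : unitBall X →ᵇ ℂ}
    (hf : IsHolomorphic g) {r : ℕ → ℝ} {N : ℕ → ℕ} (hr : ∀ k, 0 < r k ∧ r k < 1)
    (hr1 : Tendsto r atTop (𝓝 1)) (hN : Tendsto N atTop atTop) {z : Bidual X} (hz : ‖z‖ < 1) :
    Tendsto (fun k => (dilatedTaylor hf (r k) (N k)).aronBerner z) atTop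
      (𝓝 (∑' n, arensExt n (taylorForm g n) fun _ => z)) := by
  have e : ∀ k, (dilatedTaylor hf (r k) (N k)).aronBerner z = ∑' n, if n ∈ Finset.range (N k + 1)
      then (r k : ℂ) ^ n * arensExt n (taylorForm g n) fun _ => z else 0 := fun k => by
    rw [tsum_eq_sum (s := Finset.range (N k + 1)) fun n hn => if_neg hn]
    refine Finset.sum_congr rfl fun n hn => ?_
    rw [if_pos hn]
    exact arensExt_smul _ _ _ _
  simp_rw [e]
  refine tendsto_tsum_of_dominated_convergence (bound := fun n => ‖g‖ * ‖z‖ ^ n)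
    ((summable_geometric_of_lt_one (norm_nonneg z) hz).mul_left _) (fun n => ?_)
    (Eventually.of_forall fun k n => ?_)
  · have h1 : Tendsto (fun k => (r k : ℂ) ^ n * arensExt n (taylorForm g n) fun _ => z) atTop
        (𝓝 (((1 : ℝ) : ℂ) ^ n * arensExt n (taylorForm g n) fun _ => z)) :=
      (((Complex.continuous_ofReal.tendsto 1).comp hr1).pow n).mul_const _
    rw [Complex.ofReal_one, one_pow, one_mul] at h1
    refine h1.congr' ?_
    filter_upwards [hN.eventually_ge_atTop n] with k hk
    rw [if_pos (Finset.mem_range.2 (by omega))]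
  · split_ifs
    · rw [norm_mul, norm_pow, Complex.norm_real, Real.norm_of_nonneg (hr k).1.le]
      exact (mul_le_of_le_one_left (norm_nonneg _) (pow_le_one₀ (hr k).1.le (hr k).2.le)).trans
        (norm_arensExt_taylorForm_le_pow hf n hz.le)
    · rw [norm_zero]; positivity

/-- Every `g ∈ A_u(B)` has an Aron-Berner extension to the closed unit ball of the bidual, and
`g` tends to its value at `z` along every filter that converges to `z` in the polynomial-star
topology. -/
theorem exists_isAronBernerExt [CompleteSpace X] {g : unitBall X →ᵇ ℂ} (hg : g ∈ Au X) :
    ∃ G : Bidual X → ℂ, IsAronBernerExt g G ∧ ∀ z ∈ closedBall (0 : Bidual X) 1,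
      ∀ l : Filter (unitBall X),
        (∀ P : ContPoly X, Tendsto (fun x : unitBall X => P.eval x) l (𝓝 (P.aronBerner z))) →
        Tendsto g l (𝓝 (G z)) := by
  obtain ⟨hf, hu⟩ := hg
  obtain ⟨r, N, hr, hr1, hN, h⟩ := exists_seq_dilatedTaylor hf hu
  set Q : ℕ → ContPoly X := fun k => dilatedTaylor hf (r k) (N k) with hQ
  have hex : ∀ z : Bidual X, ∃ w : ℂ, ‖z‖ ≤ 1 → ∀ k : ℕ, ‖(Q k).aronBerner z - w‖ ≤ 1 / (k + 1) := by
    intro z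
    by_cases hz : ‖z‖ ≤ 1
    swap
    · exact ⟨0, fun h => absurd h hz⟩
    -- The candidate value `w` is any cluster value of `g` along points of `B` tending to `z`; the
    -- bound on `Q k - g` then passes to the limit for all `k` at once.
    obtain ⟨l, hl, hlP⟩ := exists_filter_tendsto_aronBerner hz
    let U := Ultrafilter.of l
    have hU : (U : Filter (unitBall X)) ≤ l := Ultrafilter.of_le l
    obtain ⟨w, -, hw⟩ := (isCompact_closedBall (0 : ℂ) ‖g‖).ultrafilter_le_nhds (U.map g) (by
      rw [Ultrafilter.coe_map, le_principal_iff, mem_map]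
      exact univ_mem' fun x => by simpa using g.norm_coe_le_norm x)
    refine ⟨w, fun _ k => le_of_tendsto (((hlP (Q k)).mono_left hU).sub hw).norm ?_⟩
    exact Eventually.of_forall fun x => h k x
  choose G hG using hex
  have hunif : TendstoUniformlyOn (fun k z => (Q k).aronBerner z) G atTop
      (closedBall (0 : Bidual X) 1) := by
    rw [Metric.tendstoUniformlyOn_iff]
    intro ε hε
    filter_upwards [(tendsto_one_div_add_atTop_nhds_zero_nat (𝕜 := ℝ)).eventually
      (gt_mem_nhds hε)] with k hk z hz
    rw [dist_comm, dist_eq_norm]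
    exact (hG z (by simpa using hz) k).trans_lt hk
  refine ⟨G, ⟨fun z hz => ?_, ?_⟩, fun z hz l hl => ?_⟩
  · have hz' : ‖z‖ < 1 := by simpa using hz
    have h1 := tendsto_aronBerner_dilatedTaylor hf hr hr1 hN hz'
    have h2 := hunif.tendsto_at (ball_subset_closedBall hz)
    rw [tendsto_nhds_unique h2 h1]
    exact (Summable.of_norm_bounded ((summable_geometric_of_lt_one (norm_nonneg z) hz').mul_left
      ‖g‖) fun n => norm_arensExt_taylorForm_le_pow hf n hz'.le).hasSum
  · exact hunif.continuousOn (Frequently.of_forall fun k =>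
      (Q k).continuous_aronBerner.continuousOn)
  · rw [Metric.tendsto_nhds]
    intro ε hε
    obtain ⟨k, hk⟩ := ((tendsto_one_div_add_atTop_nhds_zero_nat (𝕜 := ℝ)).eventually
      (gt_mem_nhds (show 0 < ε / 3 by positivity))).exists
    filter_upwards [Metric.tendsto_nhds.1 (hl (Q k)) (ε / 3) (by positivity)] with x hx
    have h1 := h k x
    rw [← dist_eq_norm, dist_comm] at h1
    have h2 := hG z (by simpa using hz) k
    rw [← dist_eq_norm] at h2
    have h3 := dist_triangle4 (g x) ((Q k).eval x) ((Q k).aronBerner z) (G z)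
    simp only [hQ] at h1 h2 h3 hx
    linarith

/-! ### Cluster values as values of characters. -/

/-- The character of `H` given by evaluation at a point of the unit ball. -/
noncomputable def evalCharacter (H : Subalgebra ℂ (unitBall X →ᵇ ℂ)) [CompleteSpace H]
    (x : unitBall X) : WeakDual.characterSpace ℂ H :=
  WeakDual.CharacterSpace.equivAlgHom.symm
    { toFun := fun h => (h : unitBall X →ᵇ ℂ) x
      map_one' := rfl
      map_mul' := fun _ _ => rfl
      map_zero' := rfl
      map_add' := fun _ _ => rfl
      commutes' := fun _ => rfl }

end PolyCluster

theorem theorem2p2 {X : Type*} [NormedAddCommGroup X] [NormedSpace ℂ X] [CompleteSpace X]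
    (H : Subalgebra ℂ (BoundedContinuousFunction (PolyCluster.unitBall X) ℂ))
    (hclosed : IsClosed (H : Set (BoundedContinuousFunction (PolyCluster.unitBall X) ℂ)))
    (hAu : PolyCluster.Au X ≤ H) (hHinf : H ≤ PolyCluster.Hinf X)
    (x₀ : PolyCluster.Bidual X) (hx₀ : x₀ ∈ Metric.closedBall (0 : PolyCluster.Bidual X) 1)
    (f : H) :
    PolyCluster.polyClusterSet (f : BoundedContinuousFunction (PolyCluster.unitBall X) ℂ) x₀ ⊆
      WeakDual.gelfandTransform ℂ H f '' PolyCluster.polyFiber H hAu x₀ := by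
  rintro c ⟨ι, _, _, _, x, hx, hc⟩
  -- Completeness makes point evaluations continuous characters and the character space compact.
  have : CompleteSpace H := hclosed.completeSpace_coe
  let U : Ultrafilter ι := Ultrafilter.of atTop
  have hU : (U : Filter ι) ≤ atTop := Ultrafilter.of_le _
  obtain ⟨τ, -, hτ⟩ := (isCompact_univ (X := WeakDual.characterSpace ℂ H)).ultrafilter_le_nhds
    (U.map fun α => PolyCluster.evalCharacter H (x α)) (by simp)
  have hlim : ∀ h : H, Tendsto (fun α => (h : BoundedContinuousFunction _ ℂ) (x α)) U
      (𝓝 (τ h)) := fun h =>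
    ((WeakDual.gelfandTransform ℂ H h).continuous.tendsto τ).comp
      (show Tendsto (fun α => PolyCluster.evalCharacter H (x α)) U (𝓝 τ) from hτ)
  refine ⟨τ, fun g => ?_, tendsto_nhds_unique (hlim f) (hc.mono_left hU)⟩
  obtain ⟨G, hG, hGlim⟩ := PolyCluster.exists_isAronBernerExt g.2
  refine ⟨G, hG, ?_⟩
  rw [PolyCluster.restrictAu_apply]
  refine tendsto_nhds_unique (hlim _) ?_
  exact (hGlim x₀ hx₀ (map x atTop) hx).comp (tendsto_map.mono_left hU)
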